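/- Let $f:\mathbb R^n\to\mathbb R$ be continuously differentiable with locally Lipschitz gradient, let $x^\star$ be its unique minimizer, $f^\star=f(x^\star)$, and suppose that $f$ satisfies the Polyak–Łojasiewicz inequality $\tfrac12\|\nabla f(x)\|^2\ge\mu\,(f(x)-f^\star)$ for all $x\in\mathbb R^n$, with some $\mu>0$. Let $c_1,c_2>0$, $p_1>2$ and $p_2\in(1,2)$ satisfy $$2+\frac1{p_1-2}=\frac1{2-p_2},$$ and put $$p=c_1(2\mu)^{\frac{p_1}{2(p_1-1)}},\qquad q=c_2(2\mu)^{\frac{p_2}{2(p_2-1)}},\qquad \xi=\frac{2p_1-2}{p_1-2}.$$ For $\eta>0$ consider the forward-Euler iteration started at $x_0\in\mathbb R^n$, $$x_{k+1}=x_k-\eta c_1\frac{\nabla f(x_k)}{\|\nabla f(x_k)\|^{\frac{p_1-2}{p_1-1}}}-\eta c_2\frac{\nabla f(x_k)}{\|\nabla f(x_k)\|^{\frac{p_2-2}{p_2-1}}},$$ where $x_{k+1}=x_k$ if $\nabla f(x_k)=0$. Then for every $x_0\in\mathbb R^n$ and every $\epsilon>0$ there is $\eta^*>0$ such that for all $\eta\in(0,\eta^*]$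 the iterates satisfy $$\|x_k-x^\star\|\le\begin{cases}\sqrt{\dfrac2\mu}\left(\sqrt{\dfrac pq}\,\tan\!\left(\dfrac\pi2-\dfrac{\sqrt{pq}}{\xi}\,\eta k\right)\right)^{\xi/2}+\epsilon, & 1\le k\le k^*,\\[2ex] \epsilon, & k>k^*,\end{cases}\qquad k^*=\left\lceil\frac{\xi\pi}{2\eta\sqrt{pq}}\right\rceil .$$ (Here the tangent is replaced by $0$ if its argument is negative, which can happen only for $k=k^*$; at $k=0$ the tangent is $+\infty$ and nothing is claimed.) -/

import Mathlib

noncomputable section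

/-- `f : ℝⁿ → ℝ` is `C¹` with locally Lipschitz gradient, attains its minimum at the unique
minimizer `xs`, and satisfies the Polyak-Lojasiewicz inequality with constant `μ > 0`. -/
structure PLFunction {n : ℕ} (f : EuclideanSpace ℝ (Fin n) → ℝ)
    (xs : EuclideanSpace ℝ (Fin n)) (μ : ℝ) : Prop where
  contDiff : ContDiff ℝ 1 f
  locallyLipschitz_gradient : LocallyLipschitz (gradient f)
  isMin : ∀ x, f xs ≤ f x
  unique_min : ∀ y, (∀ x, f y ≤ f x) → y = xs
  mu_pos : 0 < μ
  pl : ∀ x, μ * (f x - f xs) ≤ 1 / 2 * ‖gradient f x‖ ^ 2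

open Classical in
/-- The right-hand side of the fixed-time stable gradient flow. -/
def fxtsField {n : ℕ} (f : EuclideanSpace ℝ (Fin n) → ℝ) (c₁ c₂ p₁ p₂ : ℝ)
    (x : EuclideanSpace ℝ (Fin n)) : EuclideanSpace ℝ (Fin n) :=
  if gradient f x = 0 then 0
  else -(c₁ / ‖gradient f x‖ ^ ((p₁ - 2) / (p₁ - 1))) • gradient f x
    - (c₂ / ‖gradient f x‖ ^ ((p₂ - 2) / (p₂ - 1))) • gradient f x

/-- `x` is the forward-Euler trajectory with step `η` started at `x₀`. -/
def IsEulerTrajectory {n : ℕ} (F : EuclideanSpace ℝ (Fin n) → EuclideanSpace ℝ (Fin n))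
    (η : ℝ) (x₀ : EuclideanSpace ℝ (Fin n)) (x : ℕ → EuclideanSpace ℝ (Fin n)) : Prop :=
  x 0 = x₀ ∧ ∀ k, x (k + 1) = x k + η • F (x k)

/-- The coefficient `c (2μ)^(r / (2 (r - 1)))`; it is `p` for `(c₁, p₁)` and `q` for `(c₂, p₂)`. -/
def decayCoeff (μ c r : ℝ) : ℝ := c * (2 * μ) ^ (r / (2 * (r - 1)))

/-- The exponent parameter `ξ = (2 p₁ - 2) / (p₁ - 2)`. -/
def xiParam (p₁ : ℝ) : ℝ := (2 * p₁ - 2) / (p₁ - 2)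

/-- The switching index `k* = ⌈ξ π / (2 η √(p q))⌉`. -/
def kStar (ξ p q η : ℝ) : ℕ := ⌈ξ * Real.pi / (2 * η * Real.sqrt (p * q))⌉₊

/-- `m^(-1/2) (√(p/q) tan (π/2 - √(p q) t / ξ))^(ξ/2)`, used for `t > 0` (at `t = 0` the tangent
is infinite). The positive part matters only at the last index `k*`, where rounding up can make
the angle slightly negative and the real power meaningless; the expression is then `0`. -/
def tanBound (m ξ p q t : ℝ) : ℝ :=
  1 / Real.sqrt m *
    (Real.sqrt (p / q) * max 0 (Real.tan (Real.pi / 2 - Real.sqrt (p * q) / ξ * t))) ^ (ξ / 2)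

end

open Real

/-! Along the continuous flow, V = f - f* satisfies V' ≤ -p V^(1 - 1/ξ) - q V^(1 + 1/ξ), so θ =
arctan(√(q/p) V^(1/ξ)) starts below π/2 and falls at rate at least √(pq)/ξ. Since x^(1/ξ) and arctan
are concave on [0, ∞), tangent-line bounds carry this over to the explicit scheme without
discretisation error (`arctan_rpow_le_sub`).

By the descent lemma, the actual Euler step loses only a factor 1 - Kη in the rate outside {V ≤ ε₀},
and from inside it cannot climb above 2ε₀ (`PLFunction.exists_euler_step_decrease`). Over the O(1/η)
steps up to k* the loss in θ is O(η), paid for by the initial gap π/2 - θ > 0. Quadratic growth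
turns bounds on V into distances and keeps sublevel sets bounded. -/

/-! ### Scalar comparison in the arctan variable -/

/-- The tangent-line inequality for `arctan`, which is concave on `[0, ∞)`. -/
lemma arctan_le_add_sub_div {v w : ℝ} (hv : 0 ≤ v) (hvw : v ≤ w) :
    arctan v ≤ arctan w + (v - w) / (1 + w ^ 2) := by
  have hmono : MonotoneOn (fun u => arctan u - u / (1 + w ^ 2)) (Set.Icc 0 w) := by
    have hd : ∀ u : ℝ, HasDerivAt (fun u => arctan u - u / (1 + w ^ 2))
        (1 / (1 + u ^ 2) - 1 / (1 + w ^ 2)) u :=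
      fun u => (hasDerivAt_arctan u).sub ((hasDerivAt_id u).div_const _)
    refine monotoneOn_of_deriv_nonneg (convex_Icc 0 w)
      (fun u _ => (hd u).continuousAt.continuousWithinAt)
      (fun u _ => (hd u).differentiableAt.differentiableWithinAt) fun u hu => ?_
    rw [interior_Icc] at hu
    rw [(hd u).deriv, sub_nonneg]
    have := hu.1
    have := hu.2
    gcongr
  have h := hmono ⟨hv, hvw⟩ ⟨hv.trans hvw, le_rfl⟩ hvw
  simp only at h
  rw [sub_div]
  linarith

/-- The tangent-line inequality for `x ↦ x ^ r` with `0 ≤ r ≤ 1`. -/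
lemma rpow_le_add_mul_rpow_sub_one {V V' r : ℝ} (hV : 0 < V) (hV' : 0 ≤ V') (hr₀ : 0 ≤ r)
    (hr₁ : r ≤ 1) : V' ^ r ≤ V ^ r + r * V ^ (r - 1) * (V' - V) := by
  have hs : -1 ≤ V' / V - 1 := by
    have : 0 ≤ V' / V := by positivity
    linarith
  have h := rpow_one_add_le_one_add_mul_self hs hr₀ hr₁
  rw [add_sub_cancel, div_rpow hV' hV.le, div_le_iff₀ (rpow_pos_of_pos hV r)] at h
  refine h.trans (le_of_eq ?_)
  rw [rpow_sub_one hV.ne']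
  field_simp

/-- One step of the explicit scheme for `V' = -p V^(1 - 1/ξ) - q V^(1 + 1/ξ)` lowers
`arctan (√(q/p) V^(1/ξ))` at least as much as the exact flow does. -/
lemma arctan_rpow_le_sub {V V' p q ξ h : ℝ} (hV : 0 < V) (hV' : 0 ≤ V') (hp : 0 < p)
    (hq : 0 < q) (hξ : 1 ≤ ξ) (hh : 0 ≤ h)
    (hstep : V' ≤ V - h * (p * V ^ (1 - 1 / ξ) + q * V ^ (1 + 1 / ξ))) :
    arctan (√(q / p) * V' ^ (1 / ξ)) ≤ arctan (√(q / p) * V ^ (1 / ξ)) - h * (√(p * q) / ξ) := by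
  have hξ₀ : 0 < ξ := by linarith
  have hr₁ : 1 / ξ ≤ 1 := by rw [div_le_one hξ₀]; exact hξ
  -- In W = V^(1/ξ) the scheme becomes an explicit step for the Riccati equation W' = -(p + q W²)/ξ.
  have hW : V' ^ (1 / ξ) ≤ V ^ (1 / ξ) - h / ξ * (p + q * (V ^ (1 / ξ)) ^ 2) := by
    refine (rpow_le_add_mul_rpow_sub_one hV hV' (by positivity) hr₁).trans ?_
    have h1 : V ^ (1 / ξ - 1) * V ^ (1 - 1 / ξ) = 1 := by
      rw [← rpow_add hV]; norm_num
    have h2 : V ^ (1 / ξ - 1) * V ^ (1 + 1 / ξ) = (V ^ (1 / ξ)) ^ 2 := by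
      rw [← rpow_add hV, sq, ← rpow_add hV]; ring_nf
    have h3 : 1 / ξ * V ^ (1 / ξ - 1) * (V' - V) ≤ 1 / ξ * V ^ (1 / ξ - 1) *
        (-(h * (p * V ^ (1 - 1 / ξ) + q * V ^ (1 + 1 / ξ)))) := by
      gcongr; linarith
    have h4 : 1 / ξ * V ^ (1 / ξ - 1) * (-(h * (p * V ^ (1 - 1 / ξ) + q * V ^ (1 + 1 / ξ)))) =
        -(h / ξ * (p * (V ^ (1 / ξ - 1) * V ^ (1 - 1 / ξ)) +
          q * (V ^ (1 / ξ - 1) * V ^ (1 + 1 / ξ)))) := by ring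
    rw [h1, h2] at h4
    linarith
  set W := V ^ (1 / ξ)
  set W' := V' ^ (1 / ξ)
  have hW'₀ : 0 ≤ W' := by positivity
  have hdec : 0 ≤ h / ξ * (p + q * W ^ 2) := by positivity
  refine (arctan_le_add_sub_div (w := √(q / p) * W) (by positivity) (by gcongr; linarith)).trans ?_
  have hs : √(q / p) ^ 2 = q / p := sq_sqrt (by positivity)
  have hpq : √(q / p) * p = √(p * q) := by
    rw [sqrt_div' _ hp.le, sqrt_mul hp.le]
    have := mul_self_sqrt hp.le
    field_simp
    linarith
  have hle : (√(q / p) * W' - √(q / p) * W) / (1 + (√(q / p) * W) ^ 2) ≤ -(h * (√(p * q) / ξ)) := by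
    rw [div_le_iff₀ (by positivity), mul_pow, hs]
    calc √(q / p) * W' - √(q / p) * W = √(q / p) * (W' - W) := by ring
      _ ≤ √(q / p) * (-(h / ξ * (p + q * W ^ 2))) := by gcongr; linarith
      _ = -(h * (√(q / p) * p / ξ)) * (1 + q / p * W ^ 2) := by field_simp
      _ = _ := by rw [hpq]
  linarith

/-! ### Descent lemma and quadratic growth -/

section Descent

variable {E : Type*} [NormedAddCommGroup E] [InnerProductSpace ℝ E] [CompleteSpace E]

/-- The descent lemma, with constant `L` instead of the optimal `L / 2`. -/
lemma le_add_inner_gradient_add_sq {f : E → ℝ} {s : Set E} {L : NNReal} (hs : Convex ℝ s)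
    (hf : Differentiable ℝ f) (hL : LipschitzOnWith L (gradient f) s) {x y : E} (hx : x ∈ s)
    (hy : y ∈ s) : f y ≤ f x + inner ℝ (gradient f x) (y - x) + L * ‖y - x‖ ^ 2 := by
  have hseg : segment ℝ x y ⊆ s := hs.segment_subset hx hy
  have key := (convex_segment (𝕜 := ℝ) x y).norm_image_sub_le_of_norm_hasFDerivWithin_le'
    (f := f) (f' := fun z => InnerProductSpace.toDual ℝ E (gradient f z))
    (φ := InnerProductSpace.toDual ℝ E (gradient f x)) (C := L * ‖y - x‖)
    (fun z _ => ((hf z).hasGradientAt.hasFDerivAt).hasFDerivWithinAt)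
    (fun z hz => by
      rw [← map_sub, LinearIsometryEquiv.norm_map]
      refine (hL.norm_sub_le (hseg hz) hx).trans ?_
      gcongr
      rw [segment_eq_image'] at hz
      obtain ⟨t, ht, rfl⟩ := hz
      rw [add_sub_cancel_left, norm_smul, Real.norm_of_nonneg ht.1]
      exact mul_le_of_le_one_left (norm_nonneg _) ht.2)
    (left_mem_segment ℝ x y) (right_mem_segment ℝ x y)
  rw [InnerProductSpace.toDual_apply_apply, Real.norm_eq_abs] at key
  have := (abs_le.1 key).2
  nlinarith

end Descent

/-- A point where `√(f - f xs)` cannot be decreased at rate more than `m`, `m² < μ / 2`, is the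
minimizer. -/
lemma PLFunction.eq_of_forall_sqrt_le {n : ℕ} {f : EuclideanSpace ℝ (Fin n) → ℝ}
    {xs y : EuclideanSpace ℝ (Fin n)} {μ m : ℝ} (hf : PLFunction f xs μ)
    (hmμ : m ^ 2 < μ / 2)
    (hy : ∀ z, √(f y - f xs) ≤ √(f z - f xs) + m * ‖z - y‖) : y = xs := by
  by_contra hne
  have hV : 0 < f y - f xs := by
    by_contra hle
    exact hne (hf.unique_min y fun x => by linarith [hf.isMin x])
  set g := gradient f y
  have hd : DifferentiableAt ℝ f y := hf.contDiff.differentiable one_ne_zero y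
  -- Along steepest descent the hypothesis forces ‖g‖ ≤ 2m√(f y - f xs), which contradicts the PL
  -- inequality.
  have hline : HasDerivAt (fun t : ℝ => y - t • g) (-g) 0 := by
    simpa using ((hasDerivAt_id (0 : ℝ)).smul_const g).const_sub y
  have hcomp : HasDerivAt (fun t : ℝ => √(f (y - t • g) - f xs))
      (-‖g‖ ^ 2 / (2 * √(f y - f xs))) 0 := by
    have h1 : HasFDerivAt f (InnerProductSpace.toDual ℝ _ g) (y - (0 : ℝ) • g) := by
      rw [zero_smul, sub_zero]
      exact hd.hasGradientAt.hasFDerivAt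
    have h2 := ((h1.comp_hasDerivAt (0 : ℝ) hline).sub_const (f xs)).sqrt (by simpa using hV.ne')
    simpa [Function.comp_def] using h2
  have hlim := hcomp.tendsto_slope_zero_right
  have hge : -(m * ‖g‖) ≤ -‖g‖ ^ 2 / (2 * √(f y - f xs)) := by
    refine ge_of_tendsto hlim ?_
    filter_upwards [self_mem_nhdsWithin] with t ht
    have ht : 0 < t := ht
    have := hy (y - t • g)
    rw [show y - t • g - y = -(t • g) by abel, norm_neg, norm_smul, Real.norm_of_nonneg ht.le]
      at this
    simp only [zero_add, zero_smul, sub_zero, smul_eq_mul]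
    rw [inv_mul_eq_div, le_div_iff₀ ht]
    linarith
  have hs : 0 < √(f y - f xs) := sqrt_pos.2 hV
  have hsq : √(f y - f xs) ^ 2 = f y - f xs := sq_sqrt hV.le
  have hpl := hf.pl y
  have hμ := hf.mu_pos
  rw [le_div_iff₀ (by positivity)] at hge
  have hg : 0 < ‖g‖ := by
    by_contra h0
    have : ‖g‖ = 0 := le_antisymm (not_lt.1 h0) (norm_nonneg _)
    change _ ≤ 1 / 2 * ‖g‖ ^ 2 at hpl
    rw [this] at hpl
    nlinarith [mul_pos hμ hV]
  have hle : ‖g‖ ≤ 2 * m * √(f y - f xs) := by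
    refine le_of_mul_le_mul_left ?_ hg
    nlinarith
  have : ‖g‖ ^ 2 ≤ (2 * m * √(f y - f xs)) ^ 2 := by gcongr
  rw [mul_pow, hsq] at this
  change _ ≤ 1 / 2 * ‖g‖ ^ 2 at hpl
  nlinarith

/-- The Polyak-Lojasiewicz inequality implies quadratic growth. -/
lemma PLFunction.quadratic_growth {n : ℕ} {f : EuclideanSpace ℝ (Fin n) → ℝ}
    {xs : EuclideanSpace ℝ (Fin n)} {μ : ℝ} (hf : PLFunction f xs μ)
    (x : EuclideanSpace ℝ (Fin n)) : μ / 2 * ‖x - xs‖ ^ 2 ≤ f x - f xs := by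
  have hμ := hf.mu_pos
  have hmain : ∀ m : ℝ, 0 < m → m < √(μ / 2) → m * ‖x - xs‖ ≤ √(f x - f xs) := by
    intro m hm hlt
    -- Ekeland-type argument: by the triangle inequality, a minimizer y of this coercive function
    -- meets the hypothesis of `PLFunction.eq_of_forall_sqrt_le`.
    have hcont : Continuous fun y => √(f y - f xs) + m * ‖y - x‖ := by
      have := hf.contDiff.continuous
      fun_prop
    have htend : Filter.Tendsto (fun y => √(f y - f xs) + m * ‖y - x‖)
        (Filter.cocompact (EuclideanSpace ℝ (Fin n))) Filter.atTop := by
      refine Filter.tendsto_atTop_mono (f := fun y => m * ‖y - x‖)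
        (fun y => by linarith [sqrt_nonneg (f y - f xs)]) ?_
      refine Filter.Tendsto.const_mul_atTop hm ?_
      simpa only [dist_eq_norm] using tendsto_dist_right_cocompact_atTop x
    obtain ⟨y, hy⟩ := hcont.exists_forall_le htend
    have hyx : y = xs := by
      refine hf.eq_of_forall_sqrt_le (m := m) ?_ fun z => ?_
      · have := pow_lt_pow_left₀ hlt hm.le two_ne_zero
        rwa [sq_sqrt (by positivity)] at this
      · have h1 := hy z
        have h2 : ‖z - x‖ ≤ ‖z - y‖ + ‖y - x‖ := norm_sub_le_norm_sub_add_norm_sub z y x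
        nlinarith
    have := hy x
    simp only [hyx, sub_self, sqrt_zero, norm_zero, mul_zero, add_zero, zero_add] at this
    rwa [norm_sub_rev] at this
  have hlim : √(μ / 2) * ‖x - xs‖ ≤ √(f x - f xs) := by
    have hs : 0 < √(μ / 2) := by positivity
    have htend : Filter.Tendsto (fun m : ℝ => m * ‖x - xs‖)
        (nhdsWithin (√(μ / 2)) (Set.Iio (√(μ / 2)))) (nhds (√(μ / 2) * ‖x - xs‖)) :=
      ((continuous_id.mul continuous_const).tendsto _).mono_left nhdsWithin_le_nhds
    refine le_of_tendsto htend ?_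
    filter_upwards [Ioo_mem_nhdsLT hs] with m hm
    exact hmain m hm.1 hm.2
  have := pow_le_pow_left₀ (by positivity) hlim 2
  rwa [mul_pow, sq_sqrt (by positivity), sq_sqrt (by linarith [hf.isMin x])] at this

/-! ### One Euler step -/

/-- Away from critical points the field is the gradient rescaled by a sum of powers of its norm
with opposite exponents. -/
lemma fxtsField_eq_neg_smul {n : ℕ} {f : EuclideanSpace ℝ (Fin n) → ℝ} {c₁ c₂ p₁ p₂ a : ℝ}
    (ha₁ : (p₁ - 2) / (p₁ - 1) = a) (ha₂ : (p₂ - 2) / (p₂ - 1) = -a)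
    {x : EuclideanSpace ℝ (Fin n)} (hx : gradient f x ≠ 0) :
    fxtsField f c₁ c₂ p₁ p₂ x =
      -(c₁ * ‖gradient f x‖ ^ (-a) + c₂ * ‖gradient f x‖ ^ a) • gradient f x := by
  rw [fxtsField, if_neg hx, ha₁, ha₂, rpow_neg (norm_nonneg _), div_inv_eq_mul, div_eq_mul_inv,
    neg_add, add_smul, neg_smul, neg_smul, ← sub_eq_add_neg]

lemma norm_fxtsField_le {n : ℕ} {f : EuclideanSpace ℝ (Fin n) → ℝ} {c₁ c₂ p₁ p₂ a G : ℝ}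
    (hc₁ : 0 < c₁) (hc₂ : 0 < c₂) (ha₁ : (p₁ - 2) / (p₁ - 1) = a)
    (ha₂ : (p₂ - 2) / (p₂ - 1) = -a) (ha : 0 < a) (ha' : a < 1)
    {x : EuclideanSpace ℝ (Fin n)} (hG : ‖gradient f x‖ ≤ G) :
    ‖fxtsField f c₁ c₂ p₁ p₂ x‖ ≤ c₁ * G ^ (1 - a) + c₂ * G ^ (1 + a) := by
  have hG₀ : 0 ≤ G := (norm_nonneg _).trans hG
  by_cases hx : gradient f x = 0
  · rw [fxtsField, if_pos hx, norm_zero]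
    positivity
  · have hg : 0 < ‖gradient f x‖ := norm_pos_iff.2 hx
    rw [fxtsField_eq_neg_smul ha₁ ha₂ hx, norm_smul, norm_neg,
      Real.norm_of_nonneg (by positivity)]
    calc _ = c₁ * ‖gradient f x‖ ^ (1 - a) + c₂ * ‖gradient f x‖ ^ (1 + a) := by
          rw [sub_eq_add_neg, rpow_add hg, rpow_add hg, rpow_one]; ring
      _ ≤ _ := by gcongr

/-- On a sublevel set, and for small steps, an Euler step keeps `{f - f xs ≤ ε₀}` inside
`{f - f xs ≤ 2 ε₀}` and, from outside of it, decreases `f - f xs` at the rate of the continuous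
flow up to a factor `1 - K η`. -/
lemma PLFunction.exists_euler_step_decrease {n : ℕ} {f : EuclideanSpace ℝ (Fin n) → ℝ}
    {xs : EuclideanSpace ℝ (Fin n)} {μ c₁ c₂ p₁ p₂ a : ℝ} (hf : PLFunction f xs μ)
    (hc₁ : 0 < c₁) (hc₂ : 0 < c₂) (ha₁ : (p₁ - 2) / (p₁ - 1) = a)
    (ha₂ : (p₂ - 2) / (p₂ - 1) = -a) (ha : 0 < a) (ha' : a < 1) (C : ℝ) {ε₀ : ℝ} (hε₀ : 0 < ε₀) :
    ∃ K ηs : ℝ, 0 < K ∧ 0 < ηs ∧ ∀ η : ℝ, 0 < η → η ≤ ηs → ∀ x, f x - f xs ≤ C →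
      (f x - f xs ≤ ε₀ → f (x + η • fxtsField f c₁ c₂ p₁ p₂ x) - f xs ≤ 2 * ε₀) ∧
      (ε₀ < f x - f xs → f (x + η • fxtsField f c₁ c₂ p₁ p₂ x) - f xs ≤ f x - f xs -
        (1 - K * η) * η * (c₁ * (2 * μ) ^ (1 - a / 2) * (f x - f xs) ^ (1 - a / 2) +
          c₂ * (2 * μ) ^ (1 + a / 2) * (f x - f xs) ^ (1 + a / 2))) := by
  have hμ := hf.mu_pos
  set r : ℝ := √(2 / μ * C)
  set B := Metric.closedBall xs (r + 1)
  have hB : IsCompact B := isCompact_closedBall _ _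
  obtain ⟨L, hL⟩ := (hf.locallyLipschitz_gradient.locallyLipschitzOn
    (s := B)).exists_lipschitzOnWith_of_compact hB
  obtain ⟨G', hG'⟩ := hB.exists_bound_of_continuousOn
    hf.locallyLipschitz_gradient.continuous.continuousOn
  set G := max G' 0
  have hG₀ : 0 ≤ G := le_max_right _ _
  have hG : ∀ x ∈ B, ‖gradient f x‖ ≤ G := fun x hx => (hG' x hx).trans (le_max_left _ _)
  set M := c₁ * G ^ (1 - a) + c₂ * G ^ (1 + a)
  have hM : 0 ≤ M := by positivity
  set d := √(2 * μ * ε₀)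
  have hd : 0 < d := by positivity
  set Φ := c₁ * d ^ (-a) + c₂ * G ^ a
  have hΦ : 0 < Φ := by positivity
  -- M bounds the field on B, and Φ bounds its scalar factor where V > ε₀. The thresholds keep the
  -- step inside B (radius r + 1), the error L(ηM)² below ε₀, and 1 - Kη ≥ 0.
  refine ⟨L * Φ + 1, min 1 (min (1 / (M + 1)) (min (ε₀ / (L * M ^ 2 + 1)) (1 / (L * Φ + 1)))),
    by positivity, by positivity, fun η hη hηle x hxC => ?_⟩
  simp only [le_min_iff] at hηle
  obtain ⟨hη₁, hηM, hηε, hηΦ⟩ := hηle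
  rw [le_div_iff₀ (by positivity)] at hηM hηε hηΦ
  have hxr : ‖x - xs‖ ≤ r := by
    refine le_sqrt_of_sq_le ?_
    have := hf.quadratic_growth x
    rw [div_mul_eq_mul_div, le_div_iff₀ hμ]
    nlinarith
  have hxB : x ∈ B := by
    rw [mem_closedBall_iff_norm]
    linarith
  have hF : ‖fxtsField f c₁ c₂ p₁ p₂ x‖ ≤ M :=
    norm_fxtsField_le hc₁ hc₂ ha₁ ha₂ ha ha' (hG x hxB)
  have hηF : ‖η • fxtsField f c₁ c₂ p₁ p₂ x‖ ≤ η * M := by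
    rw [norm_smul, Real.norm_of_nonneg hη.le]
    gcongr
  have hyB : x + η • fxtsField f c₁ c₂ p₁ p₂ x ∈ B := by
    rw [mem_closedBall_iff_norm, add_sub_right_comm]
    refine (norm_add_le _ _).trans ?_
    nlinarith
  have hdesc := le_add_inner_gradient_add_sq (convex_closedBall _ _)
    (hf.contDiff.differentiable one_ne_zero) hL hxB hyB
  rw [add_sub_cancel_left] at hdesc
  have hV₀ : 0 ≤ f x - f xs := sub_nonneg.2 (hf.isMin x)
  by_cases hx : gradient f x = 0
  · have hVx : f x - f xs ≤ 0 := by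
      have := hf.pl x
      rw [hx, norm_zero] at this
      by_contra hlt
      nlinarith [mul_pos hμ (not_le.1 hlt)]
    refine ⟨fun _ => ?_, fun h => absurd h (by linarith)⟩
    rw [fxtsField, if_pos hx, smul_zero, add_zero]
    linarith
  have hg : 0 < ‖gradient f x‖ := norm_pos_iff.2 hx
  set g := gradient f x
  set φ := c₁ * ‖g‖ ^ (-a) + c₂ * ‖g‖ ^ a
  have hφ : 0 < φ := by positivity
  have hFx : fxtsField f c₁ c₂ p₁ p₂ x = -φ • g := fxtsField_eq_neg_smul ha₁ ha₂ hx
  have hin : inner ℝ g (η • fxtsField f c₁ c₂ p₁ p₂ x) = -(η * (φ * ‖g‖ ^ 2)) := by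
    rw [hFx, inner_smul_right, inner_smul_right, real_inner_self_eq_norm_sq]
    ring
  rw [hin] at hdesc
  constructor
  · intro hVε
    -- φ blows up near critical points, so the error cannot be absorbed here; the descent term is
    -- dropped instead.
    have h1 : ‖η • fxtsField f c₁ c₂ p₁ p₂ x‖ ^ 2 ≤ (η * M) ^ 2 := by gcongr
    have h2 : (L : ℝ) * ‖η • fxtsField f c₁ c₂ p₁ p₂ x‖ ^ 2 ≤ L * (η * M) ^ 2 := by gcongr
    have h3 : L * (η * M) ^ 2 ≤ ε₀ := by
      have h4 : L * (η * M) ^ 2 = η * (η * (L * M ^ 2)) := by ring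
      have h5 : η * (η * (L * M ^ 2)) ≤ 1 * (η * (L * M ^ 2)) := by gcongr
      linarith
    have h6 : 0 ≤ η * (φ * ‖g‖ ^ 2) := by positivity
    linarith
  · intro hVε
    have hVpos : 0 < f x - f xs := hε₀.trans hVε
    have hpl : 2 * μ * (f x - f xs) ≤ ‖g‖ ^ 2 := by
      have := hf.pl x
      linarith
    have hdg : d ≤ ‖g‖ := by
      refine sqrt_le_iff.2 ⟨hg.le, le_trans ?_ hpl⟩
      gcongr
    have hφΦ : φ ≤ Φ := by
      have h1 : ‖g‖ ^ (-a) ≤ d ^ (-a) := rpow_le_rpow_of_nonpos hd hdg (by linarith)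
      have h2 : ‖g‖ ≤ G := hG x hxB
      change c₁ * ‖g‖ ^ (-a) + c₂ * ‖g‖ ^ a ≤ c₁ * d ^ (-a) + c₂ * G ^ a
      gcongr
    have hpow : ∀ s : ℝ, 0 ≤ s → (2 * μ) ^ s * (f x - f xs) ^ s ≤ ‖g‖ ^ (2 * s) := by
      intro s hs
      rw [← mul_rpow (by positivity) hVpos.le, rpow_mul hg.le, rpow_two]
      gcongr
    have hrate : c₁ * (2 * μ) ^ (1 - a / 2) * (f x - f xs) ^ (1 - a / 2) +
        c₂ * (2 * μ) ^ (1 + a / 2) * (f x - f xs) ^ (1 + a / 2) ≤ φ * ‖g‖ ^ 2 := by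
      have h1 := hpow (1 - a / 2) (by linarith)
      have h2 := hpow (1 + a / 2) (by linarith)
      have h3 : φ * ‖g‖ ^ 2 = c₁ * ‖g‖ ^ (2 * (1 - a / 2)) + c₂ * ‖g‖ ^ (2 * (1 + a / 2)) := by
        rw [show 2 * (1 - a / 2) = -a + 2 by ring, show 2 * (1 + a / 2) = a + 2 by ring,
          rpow_add hg, rpow_add hg, rpow_two]
        ring
      rw [h3, mul_assoc, mul_assoc]
      gcongr
    -- The quadratic error is Lηφ times the linear decrease, and φ ≤ Φ.
    have hstep : ‖η • fxtsField f c₁ c₂ p₁ p₂ x‖ ^ 2 = η * φ * (η * (φ * ‖g‖ ^ 2)) := by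
      rw [hFx, norm_smul, norm_smul, norm_neg, Real.norm_of_nonneg hη.le,
        Real.norm_of_nonneg hφ.le]
      ring
    have hnn : 0 ≤ η * (φ * ‖g‖ ^ 2) := by positivity
    have hquad : (L : ℝ) * ‖η • fxtsField f c₁ c₂ p₁ p₂ x‖ ^ 2 ≤
        (L * Φ + 1) * η * (η * (φ * ‖g‖ ^ 2)) := by
      rw [hstep, ← mul_assoc (L : ℝ)]
      refine mul_le_mul_of_nonneg_right ?_ hnn
      have : (L : ℝ) * (η * φ) ≤ L * (η * Φ) := by gcongr
      linarith
    have hfac : 0 ≤ (1 - (L * Φ + 1) * η) * η := mul_nonneg (by linarith) hη.le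
    have := mul_le_mul_of_nonneg_left hrate hfac
    linarith

/-! ### Comparison along the trajectory -/

/-- Comparison of a perturbed explicit scheme for `V' = -p V^(1 - 1/ξ) - q V^(1 + 1/ξ)` with the
exact flow, which is linear in the variable `arctan (√(q/p) V^(1/ξ))`. -/
lemma le_or_arctan_le_of_step {V : ℕ → ℝ} {p q ξ h ε₀ C : ℝ} (hV : ∀ k, 0 ≤ V k) (hp : 0 < p)
    (hq : 0 < q) (hξ : 1 ≤ ξ) (hh : 0 ≤ h) (hε₀ : 0 < ε₀) (hC : 2 * ε₀ ≤ C) (hVC : V 0 ≤ C)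
    (hsmall : ∀ k, V k ≤ C → V k ≤ ε₀ → V (k + 1) ≤ 2 * ε₀)
    (hlarge : ∀ k, V k ≤ C → ε₀ < V k →
      V (k + 1) ≤ V k - h * (p * V k ^ (1 - 1 / ξ) + q * V k ^ (1 + 1 / ξ))) (k : ℕ) :
    V k ≤ 2 * ε₀ ∨ (V k ≤ C ∧ arctan (√(q / p) * V k ^ (1 / ξ)) ≤
      arctan (√(q / p) * V 0 ^ (1 / ξ)) - k * (h * (√(p * q) / ξ))) := by
  induction k with
  | zero => right; simpa using hVC
  | succ k ih =>
    have hkC : V k ≤ C := ih.elim (fun h => h.trans hC) And.left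
    rcases le_or_gt (V k) ε₀ with hk | hk
    · exact Or.inl (hsmall k hkC hk)
    have hstep := hlarge k hkC hk
    have hVk : 0 < V k := hε₀.trans hk
    have hdec : V (k + 1) ≤ V k := by
      have : 0 ≤ h * (p * V k ^ (1 - 1 / ξ) + q * V k ^ (1 + 1 / ξ)) := by positivity
      linarith
    -- Between ε₀ and 2ε₀ the value still decreases, so {V ≤ 2ε₀} is never left.
    rcases ih with ih | ⟨_, ih⟩
    · exact Or.inl (hdec.trans ih)
    · refine Or.inr ⟨hdec.trans hkC, ?_⟩
      have := arctan_rpow_le_sub hVk (hV (k + 1)) hp hq hξ hh hstep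
      push_cast
      linarith

/-- The comparison in `arctan` variables, translated back to a bound on the distance. -/
lemma norm_le_tanBound {D V m ξ p q t : ℝ} (hm : 0 < m) (hξ : 0 < ξ) (hp : 0 < p) (hq : 0 < q)
    (hV : 0 ≤ V) (ht : 0 < t) (hD : m * D ^ 2 ≤ V)
    (h : arctan (√(q / p) * V ^ (1 / ξ)) ≤ π / 2 - √(p * q) / ξ * t) :
    D ≤ tanBound m ξ p q t := by
  have hω : 0 < √(p * q) / ξ * t := by positivity
  have htan : √(q / p) * V ^ (1 / ξ) ≤ tan (π / 2 - √(p * q) / ξ * t) := by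
    have h0 : 0 ≤ arctan (√(q / p) * V ^ (1 / ξ)) := arctan_nonneg.2 (by positivity)
    rw [← arctan_le_arctan_iff, arctan_tan (by linarith [pi_pos]) (by linarith)]
    exact h
  have hW : V ^ (1 / ξ) ≤ √(p / q) * max 0 (tan (π / 2 - √(p * q) / ξ * t)) := by
    have h1 : √(p / q) * √(q / p) = 1 := by
      rw [← sqrt_mul (by positivity), div_mul_div_cancel₀ hq.ne', div_self hp.ne', sqrt_one]
    calc V ^ (1 / ξ) = √(p / q) * (√(q / p) * V ^ (1 / ξ)) := by rw [← mul_assoc, h1, one_mul]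
      _ ≤ _ := by gcongr; exact htan.trans (le_max_right _ _)
  have hsqrt : √V ≤ (√(p / q) * max 0 (tan (π / 2 - √(p * q) / ξ * t))) ^ (ξ / 2) := by
    calc √V = (V ^ (1 / ξ)) ^ (ξ / 2) := by
          rw [← rpow_mul hV, sqrt_eq_rpow]; congr 1; field_simp
      _ ≤ _ := by gcongr
  have hDV : D ≤ 1 / √m * √V := by
    rw [one_div, inv_mul_eq_div, ← sqrt_div hV]
    refine le_sqrt_of_sq_le ?_
    rw [le_div_iff₀ hm]
    linarith
  exact hDV.trans (mul_le_mul_of_nonneg_left hsqrt (by positivity))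

theorem theorem4 {n : ℕ} (f : EuclideanSpace ℝ (Fin n) → ℝ) (xs : EuclideanSpace ℝ (Fin n))
    (μ c₁ c₂ p₁ p₂ : ℝ) (hf : PLFunction f xs μ) (hc₁ : 0 < c₁) (hc₂ : 0 < c₂)
    (hp₁ : 2 < p₁) (hp₂ : 1 < p₂) (hp₂' : p₂ < 2)
    (hp : 2 + 1 / (p₁ - 2) = 1 / (2 - p₂))
    (x₀ : EuclideanSpace ℝ (Fin n)) (ε : ℝ) (hε : 0 < ε) :
    ∃ ηs : ℝ, 0 < ηs ∧ ∀ η : ℝ, 0 < η → η ≤ ηs →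
      ∀ x : ℕ → EuclideanSpace ℝ (Fin n),
        IsEulerTrajectory (fxtsField f c₁ c₂ p₁ p₂) η x₀ x →
          (∀ k : ℕ, 0 < k →
            k ≤ kStar (xiParam p₁) (decayCoeff μ c₁ p₁) (decayCoeff μ c₂ p₂) η →
              ‖x k - xs‖ ≤ tanBound (μ / 2) (xiParam p₁) (decayCoeff μ c₁ p₁)
                (decayCoeff μ c₂ p₂) (η * k) + ε) ∧
          (∀ k : ℕ, kStar (xiParam p₁) (decayCoeff μ c₁ p₁) (decayCoeff μ c₂ p₂) η < k →
              ‖x k - xs‖ ≤ ε) := by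
  have hμ := hf.mu_pos
  have h1 : 0 < p₁ - 2 := by linarith
  have h2 : 0 < p₁ - 1 := by linarith
  have h3 : 0 < p₂ - 1 := by linarith
  have h4 : 0 < 2 - p₂ := by linarith
  obtain ⟨a, ha₁⟩ : ∃ a, (p₁ - 2) / (p₁ - 1) = a := ⟨_, rfl⟩
  have ha : 0 < a := ha₁ ▸ div_pos h1 h2
  have ha' : a < 1 := by rw [← ha₁, div_lt_one h2]; linarith
  -- The relation between p₁ and p₂ says exactly that the two exponents are opposite.
  have ha₂ : (p₂ - 2) / (p₂ - 1) = -a := by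
    rw [← ha₁]
    field_simp at hp ⊢
    linarith
  have hξ : 1 / xiParam p₁ = a / 2 := by
    rw [xiParam, one_div_div, ← ha₁, div_div]
    congr 1; ring
  have hξ₀ : 0 < xiParam p₁ := div_pos (by linarith) h1
  have hξ₁ : 1 ≤ xiParam p₁ := by
    rw [xiParam, le_div_iff₀ h1]; linarith
  have he₁ : p₁ / (2 * (p₁ - 1)) = 1 - a / 2 := by
    rw [← ha₁]; field_simp; ring
  have he₂ : p₂ / (2 * (p₂ - 1)) = 1 + a / 2 := by
    rw [show a = -((p₂ - 2) / (p₂ - 1)) by linarith]; field_simp; ring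
  have hpdef : decayCoeff μ c₁ p₁ = c₁ * (2 * μ) ^ (1 - a / 2) := by rw [decayCoeff, he₁]
  have hqdef : decayCoeff μ c₂ p₂ = c₂ * (2 * μ) ^ (1 + a / 2) := by rw [decayCoeff, he₂]
  have hp₀ : 0 < decayCoeff μ c₁ p₁ := by rw [hpdef]; positivity
  have hq₀ : 0 < decayCoeff μ c₂ p₂ := by rw [hqdef]; positivity
  set ξ := xiParam p₁
  set p := decayCoeff μ c₁ p₁
  set q := decayCoeff μ c₂ p₂
  obtain ⟨ε₀, hε₀def⟩ : ∃ ε₀, ε₀ = μ / 4 * ε ^ 2 := ⟨_, rfl⟩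
  have hε₀ : 0 < ε₀ := by rw [hε₀def]; positivity
  have hclose : ∀ y, f y - f xs ≤ 2 * ε₀ → ‖y - xs‖ ≤ ε := by
    intro y hy
    have := hf.quadratic_growth y
    refine le_of_sq_le_sq ?_ hε.le
    refine le_of_mul_le_mul_left ?_ (half_pos hμ)
    linarith
  obtain ⟨K, η₁, hK, hη₁, hstep⟩ := hf.exists_euler_step_decrease hc₁ hc₂ ha₁ ha₂ ha ha'
    (max (f x₀ - f xs) (2 * ε₀)) hε₀
  set θ₀ := arctan (√(q / p) * (f x₀ - f xs) ^ (1 / ξ))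
  have hδ : 0 < π / 2 - θ₀ := sub_pos.2 (arctan_lt_pi_div_two _)
  set ω := √(p * q) / ξ
  have hω : 0 < ω := by positivity
  -- With ηω ≤ 1, rounding up in k* leaves kηω ≤ π/2 + 1 ≤ 3; the accumulated loss Kη·kηω ≤ 3Kη then
  -- fits in the gap π/2 - θ₀.
  refine ⟨min η₁ (min (1 / K) (min (1 / ω) ((π / 2 - θ₀) / (3 * K)))), by positivity,
    fun η hη hηle x hx => ?_⟩
  simp only [le_min_iff] at hηle
  obtain ⟨hηη₁, hηK, hηω, hηδ⟩ := hηle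
  rw [le_div_iff₀ (by positivity)] at hηK hηω hηδ
  obtain ⟨hx0, hxs⟩ := hx
  have hV : ∀ k, 0 ≤ f (x k) - f xs := fun k => sub_nonneg.2 (hf.isMin _)
  have key := le_or_arctan_le_of_step (V := fun k => f (x k) - f xs) (p := p) (q := q) (ξ := ξ)
    (h := (1 - K * η) * η) hV hp₀ hq₀ hξ₁
    (mul_nonneg (by linarith) hη.le) hε₀ (le_max_right (f x₀ - f xs) _)
    (by simp only [hx0]; exact le_max_left _ _)
    (fun k hkC hk => by
      simp only [hxs k]
      exact (hstep η hη hηη₁ (x k) hkC).1 hk)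
    (fun k hkC hk => by
      simp only [hxs k, hξ, hpdef, hqdef]
      exact (hstep η hη hηη₁ (x k) hkC).2 hk)
  simp only [hx0] at key
  have hkst : ξ * π / (2 * η * √(p * q)) * (η * ω) = π / 2 := by
    have : 0 < √(p * q) := by positivity
    simp only [ω]
    field_simp
  have hKη : 0 < K * η := by positivity
  have hηω₀ : 0 < η * ω := by positivity
  constructor
  · intro k hk0 hk
    rcases key k with hk' | ⟨-, hk'⟩
    · refine (hclose _ hk').trans (le_add_of_nonneg_left ?_)
      rw [tanBound]
      positivity
    · refine (norm_le_tanBound (half_pos hμ) hξ₀ hp₀ hq₀ (hV k)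
        (mul_pos hη (Nat.cast_pos.2 hk0)) (hf.quadratic_growth _) ?_).trans
        (le_add_of_nonneg_right hε.le)
      refine hk'.trans ?_
      have hkr : (k : ℝ) * (η * ω) ≤ 3 := by
        have h5 : (k : ℝ) < ξ * π / (2 * η * √(p * q)) + 1 :=
          (Nat.cast_le.2 hk).trans_lt (Nat.ceil_lt_add_one (by positivity))
        have h6 := mul_le_mul_of_nonneg_right h5.le hηω₀.le
        rw [add_mul, hkst] at h6
        linarith [pi_le_four]
      have h7 := mul_le_mul_of_nonneg_left hkr hKη.le
      change θ₀ - k * ((1 - K * η) * η * ω) ≤ π / 2 - ω * (η * k)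
      linarith
  · intro k hk
    rcases key k with hk' | ⟨-, hk'⟩
    · exact hclose _ hk'
    · refine hclose _ ?_
      have hkr : π / 2 ≤ (k : ℝ) * (η * ω) := by
        have h5 : ξ * π / (2 * η * √(p * q)) ≤ k :=
          (Nat.le_ceil _).trans (Nat.cast_le.2 hk.le)
        have h6 := mul_le_mul_of_nonneg_right h5 hηω₀.le
        rwa [hkst] at h6
      have h7 := mul_le_mul_of_nonneg_left hkr (show 0 ≤ 1 - K * η by linarith)
      have h8 : K * η * (π / 2) ≤ K * η * 3 := by
        gcongr; linarith [pi_le_four]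
      have h9 : arctan (√(q / p) * (f (x k) - f xs) ^ (1 / ξ)) ≤ 0 := by
        refine hk'.trans ?_
        change θ₀ - k * ((1 - K * η) * η * ω) ≤ 0
        linarith
      -- After k* the angle bound is at most 0, which is impossible for V > 0.
      by_contra hlt
      have h10 : 0 < f (x k) - f xs := by linarith
      have h11 : 0 < √(q / p) * (f (x k) - f xs) ^ (1 / ξ) := by positivity
      exact absurd (arctan_le_zero.1 h9) (not_le.2 h11)
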